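/- Let $(\mathcal{M},\otimes,\mathbb{I})$ be a symmetric monoidal abelian category which is bicomplete (has all small limits and colimits), in which every object has only a set of subobjects, and whose tensor product is additive and right exact in each variable. For an object $X$ write $\mathcal{Z}(X)=\mathrm{Hom}_{\mathcal{M}}(\mathbb{I},X)$. Then $\mathcal{Z}(\mathbb{I})=\mathrm{End}_{\mathcal{M}}(\mathbb{I})$ is a commutative ring, and for every monoid $(A,m,u)$ in $\mathcal{M}$ the group $\mathcal{Z}(A)$ is a $\mathcal{Z}(\mathbb{I})$-algebra, with product $f\cdot g=m\circ(f\otimes g)\circ(\mathbb{I}\cong\mathbb{I}\otimes\mathbb{I})$, identity element $u$, and scalar multiplication $r\cdot f=f\circ r$. Let $A^{e}=A\otimes A^{o}$, where $A^{o}$ is $A$ with the multiplication twisted by the symmetry, and let $A^e$ act on $A$ by left and right multiplication. The monoid $A$ is called an Azumaya monoid if the functor $A\otimes-:\mathcal{M}\to{}_{A^{e}}\mathcal{M}$ to the category of left $A^{e}$-modules is an equivalence of categories and $m:A\otimes A\to A$ splits as a morphism of $A$-bimodules. An object of $\mathcal{M}$ is called a Künneth object if it is a direct summand of a finite product of copies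 of $\mathbb{I}$. It is called dualizable if it has a dual object in $\mathcal{M}$ with evaluation and coevaluation morphisms satisfying the triangle identities. **Proposition.** If $A$ is an Azumaya monoid in $\mathcal{M}$ whose underlying object is a dualizable Künneth object, then $\mathcal{Z}(A)$ is an Azumaya $\mathcal{Z}(\mathbb{I})$-algebra in the classical sense: it is a finitely generated, projective and faithful $\mathcal{Z}(\mathbb{I})$-module, and the canonical algebra map $$\mathcal{Z}(A)\otimes_{\mathcal{Z}(\mathbb{I})}\mathcal{Z}(A)^{op}\longrightarrow\mathrm{End}_{\mathcal{Z}(\mathbb{I})}(\mathcal{Z}(A)),\qquad a\otimes b\longmapsto(x\mapsto axb),$$ is bijective. -/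

import Mathlib

open CategoryTheory CategoryTheory.Limits MonoidalCategory MonObj

universe v u

namespace AzumayaMonoid

section Monoidal

variable {C : Type u} [Category.{v} C] [MonoidalCategory C]

theorem endUnit_comm (f g : 𝟙_ C ⟶ 𝟙_ C) : f ≫ g = g ≫ f := by
  have hf : (λ_ (𝟙_ C)).inv ≫ (𝟙_ C ◁ f) ≫ (λ_ (𝟙_ C)).hom = f := by simp
  have hg : (λ_ (𝟙_ C)).inv ≫ (g ▷ 𝟙_ C) ≫ (λ_ (𝟙_ C)).hom = g := by
    rw [unitors_equal, rightUnitor_naturality, ← unitors_equal, Iso.inv_hom_id_assoc]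
  rw [← hf, ← hg]
  simp only [Category.assoc, Iso.hom_inv_id_assoc]
  rw [whisker_exchange_assoc]

/-- `Z(𝟙) = Hom(𝟙, 𝟙)`, the endomorphism ring of the unit object, is commutative. -/
instance endUnitCommRing [Preadditive C] : CommRing (End (𝟙_ C)) where
  mul_comm f g := endUnit_comm (C := C) g f

/-- The product of two morphisms `f g : 𝟙 ⟶ A` into a monoid `A`:
`𝟙 ≅ 𝟙 ⊗ 𝟙 ⟶ A ⊗ A ⟶ A`. -/
def unitMul (A : C) [MonObj A] (f g : 𝟙_ C ⟶ A) : 𝟙_ C ⟶ A :=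
  (λ_ (𝟙_ C)).inv ≫ (f ⊗ₘ g) ≫ μ

theorem unitMul_assoc (A : C) [MonObj A] (f g h : 𝟙_ C ⟶ A) :
    unitMul A (unitMul A f g) h = unitMul A f (unitMul A g h) := by
  unfold unitMul
  have h1 : (((λ_ (𝟙_ C)).inv ≫ (f ⊗ₘ g) ≫ μ) ⊗ₘ h) ≫ μ
      = ((λ_ (𝟙_ C)).inv ▷ 𝟙_ C) ≫ ((f ⊗ₘ g) ⊗ₘ h) ≫ μ ▷ A ≫ μ := by
    rw [← tensorHom_id, ← tensorHom_id, tensorHom_comp_tensorHom_assoc,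
      tensorHom_comp_tensorHom_assoc]
    simp only [Category.id_comp, Category.comp_id, Category.assoc]
  have h2 : (f ⊗ₘ (λ_ (𝟙_ C)).inv ≫ (g ⊗ₘ h) ≫ μ) ≫ μ
      = (𝟙_ C ◁ (λ_ (𝟙_ C)).inv) ≫ (f ⊗ₘ (g ⊗ₘ h)) ≫ A ◁ μ ≫ μ := by
    rw [← id_tensorHom, ← id_tensorHom, tensorHom_comp_tensorHom_assoc,
      tensorHom_comp_tensorHom_assoc]
    simp only [Category.id_comp, Category.comp_id, Category.assoc]
  rw [h1, h2, MonObj.mul_assoc, associator_naturality_assoc]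
  monoidal

theorem one_unitMul (A : C) [MonObj A] (f : 𝟙_ C ⟶ A) : unitMul A η f = f := by
  unfold unitMul
  simp [MonoidalCategory.tensorHom_def']

theorem unitMul_one (A : C) [MonObj A] (f : 𝟙_ C ⟶ A) : unitMul A f η = f := by
  unfold unitMul
  simp [MonoidalCategory.tensorHom_def, unitors_inv_equal]

theorem comp_unitMul (A : C) [MonObj A] (r : 𝟙_ C ⟶ 𝟙_ C) (f g : 𝟙_ C ⟶ A) :
    unitMul A (r ≫ f) g = r ≫ unitMul A f g := by
  unfold unitMul
  have : (r ≫ f) ⊗ₘ g = r ▷ 𝟙_ C ≫ (f ⊗ₘ g) := by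
    rw [← tensorHom_id, tensorHom_comp_tensorHom, Category.id_comp]
  rw [this, unitors_inv_equal, Category.assoc, rightUnitor_inv_naturality_assoc]

theorem unitMul_comp (A : C) [MonObj A] (r : 𝟙_ C ⟶ 𝟙_ C) (f g : 𝟙_ C ⟶ A) :
    unitMul A f (r ≫ g) = r ≫ unitMul A f g := by
  unfold unitMul
  have : f ⊗ₘ (r ≫ g) = 𝟙_ C ◁ r ≫ (f ⊗ₘ g) := by
    rw [← id_tensorHom, tensorHom_comp_tensorHom, Category.id_comp]
  rw [this, Category.assoc, leftUnitor_inv_naturality_assoc]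

theorem zero_unitMul [Preadditive C] [MonoidalPreadditive C] (A : C) [MonObj A] (f : 𝟙_ C ⟶ A) :
    unitMul A 0 f = 0 := by
  simp [unitMul]

theorem unitMul_zero [Preadditive C] [MonoidalPreadditive C] (A : C) [MonObj A] (f : 𝟙_ C ⟶ A) :
    unitMul A f 0 = 0 := by
  simp [unitMul]

theorem unitMul_add [Preadditive C] [MonoidalPreadditive C] (A : C) [MonObj A]
    (f g h : 𝟙_ C ⟶ A) : unitMul A f (g + h) = unitMul A f g + unitMul A f h := by
  simp [unitMul, MonoidalPreadditive.tensor_add]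

theorem add_unitMul [Preadditive C] [MonoidalPreadditive C] (A : C) [MonObj A]
    (f g h : 𝟙_ C ⟶ A) : unitMul A (f + g) h = unitMul A f h + unitMul A g h := by
  simp [unitMul, MonoidalPreadditive.add_tensor]

theorem unit_central (A : C) [MonObj A] (r : 𝟙_ C ⟶ 𝟙_ C) (f : 𝟙_ C ⟶ A) :
    unitMul A (r ≫ η) f = unitMul A f (r ≫ η) := by
  rw [comp_unitMul, unitMul_comp, one_unitMul, unitMul_one]

theorem unit_smul (A : C) [MonObj A] (r : 𝟙_ C ⟶ 𝟙_ C) (f : 𝟙_ C ⟶ A) :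
    r ≫ f = unitMul A (r ≫ η) f := by
  rw [comp_unitMul, one_unitMul]

theorem unit_map_mul (A : C) [MonObj A] (r s : 𝟙_ C ⟶ 𝟙_ C) :
    (s ≫ r) ≫ η = unitMul A (r ≫ η) (s ≫ η) := by
  rw [comp_unitMul, unitMul_comp, one_unitMul, endUnit_comm, Category.assoc]

/-- `Z(A) = Hom(𝟙, A)`. -/
def Z (A : C) : Type v := 𝟙_ C ⟶ A

instance [Preadditive C] (A : C) : AddCommGroup (Z A) :=
  inferInstanceAs (AddCommGroup (𝟙_ C ⟶ A))

/-- For a monoid `A`, the ring `Z(A)`: the addition is that of the hom group, the product of `f`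
and `g` is `𝟙 ≅ 𝟙 ⊗ 𝟙 ⟶ A ⊗ A ⟶ A`, and the identity element is the unit `η : 𝟙 ⟶ A`. -/
instance [Preadditive C] [MonoidalPreadditive C] (A : C) [MonObj A] : Ring (Z A) where
  __ := (inferInstance : AddCommGroup (Z A))
  mul f g := unitMul A f g
  one := (η : 𝟙_ C ⟶ A)
  zero_mul := zero_unitMul A
  mul_zero := unitMul_zero A
  left_distrib := unitMul_add A
  right_distrib := add_unitMul A
  one_mul := one_unitMul A
  mul_one := unitMul_one A
  mul_assoc := unitMul_assoc A

/-- For a monoid `A`, the `Z(𝟙)`-algebra structure of `Z(A)`: a scalar `r : 𝟙 ⟶ 𝟙` acts on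
`f : 𝟙 ⟶ A` by precomposition. -/
instance [Preadditive C] [MonoidalPreadditive C] (A : C) [MonObj A] :
    Algebra (End (𝟙_ C)) (Z A) where
  smul r f := CategoryStruct.comp (obj := C) r f
  algebraMap :=
    { toFun := fun r => CategoryStruct.comp (obj := C) r (η : 𝟙_ C ⟶ A)
      map_one' := Category.id_comp (η : 𝟙_ C ⟶ A)
      map_zero' := zero_comp
      map_add' := fun r s => Preadditive.add_comp (C := C) _ _ _ r s η
      map_mul' := unit_map_mul A }
  commutes' := unit_central A
  smul_def' := unit_smul A

/-- If `M` is a left module over a monoid `R`, then so is `M ⊗ X`, by acting on `M`. -/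
@[reducible]
def modTensor (R M X : C) [MonObj R] [ModObj R M] : ModObj R (M ⊗ X) where
  smul := (α_ R M X).inv ≫ γ[R, M] ▷ X
  one_smul := by
    change η ▷ (M ⊗ X) ≫ (α_ R M X).inv ≫ γ[R, M] ▷ X = (λ_ (M ⊗ X)).hom
    rw [associator_inv_naturality_left_assoc, ← comp_whiskerRight, ModObj.one_smul_self]
    simp
  mul_smul := by
    change μ ▷ (M ⊗ X) ≫ (α_ R M X).inv ≫ γ[R, M] ▷ X
      = (α_ R R (M ⊗ X)).hom ≫ R ◁ ((α_ R M X).inv ≫ γ[R, M] ▷ X) ≫ (α_ R M X).inv ≫ γ[R, M] ▷ X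
    rw [associator_inv_naturality_left_assoc, ← comp_whiskerRight, ModObj.mul_smul_self]
    monoidal

/-- The multiplication `μ : A ⊗ A ⟶ A` splits as a morphism of `A`-bimodules, where `A` acts on
`A ⊗ A` on the left through the first factor and on the right through the second factor. -/
def IsSeparable (A : C) [MonObj A] : Prop :=
  ∃ s : A ⟶ A ⊗ A, s ≫ μ = 𝟙 A ∧
    μ ≫ s = A ◁ s ≫ (α_ A A A).inv ≫ μ ▷ A ∧
    μ ≫ s = s ▷ A ≫ (α_ A A A).hom ≫ A ◁ μ

end Monoidal

section Symmetric

variable {C : Type u} [Category.{v} C] [MonoidalCategory C] [SymmetricCategory C]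

/-- The underlying object of the opposite monoid of `A`, which is that of `A`. -/
def Op (A : C) : C := A

/-- The opposite monoid: its multiplication is that of `A`, twisted by the symmetry. -/
instance (A : C) [MonObj A] : MonObj (Op A) where
  one := (η : 𝟙_ C ⟶ A)
  mul := (β_ A A).hom ≫ (μ : A ⊗ A ⟶ A)
  one_mul := by
    change (η : 𝟙_ C ⟶ A) ▷ A ≫ (β_ A A).hom ≫ μ = (λ_ A).hom
    simp
  mul_one := by
    change A ◁ (η : 𝟙_ C ⟶ A) ≫ (β_ A A).hom ≫ μ = (ρ_ A).hom
    simp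
  mul_assoc := by
    change ((β_ A A).hom ≫ μ) ▷ A ≫ (β_ A A).hom ≫ μ
      = (α_ A A A).hom ≫ A ◁ ((β_ A A).hom ≫ μ) ≫ (β_ A A).hom ≫ μ
    simp only [comp_whiskerRight, Category.assoc, BraidedCategory.braiding_naturality_left_assoc,
      MonoidalCategory.whiskerLeft_comp, BraidedCategory.braiding_naturality_right_assoc,
      MonObj.mul_assoc]
    rw [MonObj.mul_assoc_flip]
    simp only [← Category.assoc]
    congr 2
    have := BraidedCategory.yang_baxter A A A
    simp [← reassoc_of% this]

/-- The right multiplication of `A` on itself, as a left module structure over the opposite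
monoid: `b · x = x b`. -/
instance opModObj (A : C) [MonObj A] : ModObj (Op A) A where
  smul := (β_ A A).hom ≫ (μ : A ⊗ A ⟶ A)
  one_smul := MonObj.one_mul (Op A)
  mul_smul := MonObj.mul_assoc (Op A)

/-- If the actions of the monoids `R` and `S` on `X` commute with each other, then `R ⊗ S`
acts on `X` by `(a ⊗ b) · x = a · (b · x)`. -/
@[reducible]
def tensorModObj (R S X : C) [MonObj R] [MonObj S] [ModObj R X] [ModObj S X]
    (h : S ◁ γ[R, X] ≫ γ[S, X] =
      (α_ S R X).inv ≫ (β_ S R).hom ▷ X ≫ (α_ R S X).hom ≫ R ◁ γ[S, X] ≫ γ[R, X]) :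
    ModObj (R ⊗ S) X where
  smul := (α_ R S X).hom ≫ R ◁ γ[S, X] ≫ γ[R, X]
  one_smul := by
    change ((λ_ (𝟙_ C)).inv ≫ (η ⊗ₘ η)) ▷ X ≫ (α_ R S X).hom ≫ R ◁ γ[S, X] ≫ γ[R, X] = (λ_ X).hom
    simp only [MonoidalCategory.tensorHom_def, comp_whiskerRight, Category.assoc, whisker_assoc,
      Iso.inv_hom_id_assoc]
    simp only [← whiskerLeft_comp_assoc, ModObj.one_smul_self, triangle_assoc]
    have : (η : 𝟙_ C ⟶ R) ▷ 𝟙_ C ▷ X ≫ (ρ_ R).hom ▷ X ≫ γ[R, X]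
        = (ρ_ _).hom ▷ X ≫ (λ_ X).hom := by
      rw [← comp_whiskerRight_assoc, rightUnitor_naturality, comp_whiskerRight_assoc,
        ModObj.one_smul_self]
    rw [this]
    monoidal
  mul_smul := by
    change (tensorμ R S R S ≫ (μ ⊗ₘ μ)) ▷ X ≫ (α_ R S X).hom ≫ R ◁ γ[S, X] ≫ γ[R, X]
      = (α_ (R ⊗ S) (R ⊗ S) X).hom ≫ (R ⊗ S) ◁ ((α_ R S X).hom ≫ R ◁ γ[S, X] ≫ γ[R, X]) ≫
        ((α_ R S X).hom ≫ R ◁ γ[S, X] ≫ γ[R, X])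
    have h2 := congrArg (fun t => R ◁ t) h
    have h3 := congrArg (fun t => R ◁ t) (ModObj.mul_smul_self S X)
    simp only [MonoidalCategory.whiskerLeft_comp] at h2 h3
    have h5 : μ[R] ▷ (S ⊗ S) ▷ X ≫ (α_ R (S ⊗ S) X).hom ≫ R ◁ (α_ S S X).hom ≫
        R ◁ S ◁ γ[S, X] ≫ R ◁ γ[S, X] ≫ γ[R, X]
        = (α_ (R ⊗ R) (S ⊗ S) X).hom ≫ (R ⊗ R) ◁ (α_ S S X).hom ≫ (R ⊗ R) ◁ S ◁ γ[S, X] ≫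
          (R ⊗ R) ◁ γ[S, X] ≫ (α_ _ _ _).hom ≫ R ◁ γ[R, X] ≫ γ[R, X] := by
      rw [← ModObj.mul_smul_self, whisker_exchange_assoc, whisker_exchange_assoc,
        whisker_exchange_assoc, associator_naturality_left_assoc]
    have h6 : R ◁ S ◁ R ◁ γ[S, X] ≫ R ◁ (α_ S R X).inv ≫ R ◁ (β_ S R).hom ▷ X ≫
        R ◁ (α_ R S X).hom ≫ R ◁ R ◁ γ[S, X] ≫ R ◁ γ[R, X] ≫ γ[R, X] =
        R ◁ (α_ S R (S ⊗ X)).inv ≫ R ◁ (β_ S R).hom ▷ (S ⊗ X) ≫ R ◁ (α_ R S (S ⊗ X)).hom ≫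
          R ◁ R ◁ S ◁ γ[S, X] ≫ R ◁ R ◁ γ[S, X] ≫ R ◁ γ[R, X] ≫ γ[R, X] := by
      simp only [← whiskerLeft_comp_assoc]
      congr 2
      simp only [associator_inv_naturality_right_assoc, whisker_exchange_assoc,
        associator_naturality_right_assoc, MonoidalCategory.whiskerLeft_comp, Category.assoc]
      rfl
    simp only [MonoidalCategory.tensorHom_def, comp_whiskerRight, Category.assoc, whisker_assoc,
      Iso.inv_hom_id_assoc, whiskerLeft_comp, tensor_whiskerLeft, reassoc_of% h2, reassoc_of% h3,
      tensorμ, h6]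
    rw [h5]
    monoidal

/-- The enveloping monoid `Aᵉ = A ⊗ Aᵒ`. -/
abbrev Env (A : C) : C := A ⊗ Op A

/-- `A` as a left `Aᵉ`-module: `(a ⊗ b) · x = a (x b)`. -/
instance envModObj (A : C) [MonObj A] : ModObj (Env A) A :=
  letI : ModObj A A := ModObj.regular A
  tensorModObj A (Op A) A (by
    change A ◁ μ ≫ (β_ A A).hom ≫ μ = (α_ A A A).inv ≫ (β_ A A).hom ▷ A ≫ (α_ A A A).hom ≫
      A ◁ ((β_ A A).hom ≫ μ) ≫ μ
    rw [BraidedCategory.braiding_naturality_right_assoc, MonObj.mul_assoc]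
    simp)

/-- The functor `A ⊗ - : C ⥤ Aᵉ-Mod`. -/
def envFunctor (A : C) [MonObj A] : C ⥤ Mod C (Env A) where
  obj X :=
    letI := modTensor (Env A) A X
    ⟨A ⊗ X⟩
  map {X Y} f :=
    letI := modTensor (Env A) A X
    letI := modTensor (Env A) A Y
    Mod.Hom.mk'' (A ◁ f) (by
      change ((α_ (Env A) A X).inv ≫ γ[Env A, A] ▷ X) ≫ A ◁ f
        = Env A ◁ A ◁ f ≫ (α_ (Env A) A Y).inv ≫ γ[Env A, A] ▷ Y
      rw [Category.assoc, ← whisker_exchange, associator_inv_naturality_right_assoc]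
      rfl)

/-- An Azumaya monoid: `A ⊗ - : C ⥤ Aᵉ-Mod` is an equivalence of categories, and the
multiplication of `A` splits as a morphism of `A`-bimodules. -/
structure IsAzumayaMonoid (A : C) [MonObj A] : Prop where
  isEquivalence : (envFunctor A).IsEquivalence
  isSeparable : IsSeparable A

end Symmetric

/-- A Künneth object: a direct summand of a finite product of copies of the unit object. -/
def IsKunneth {C : Type u} [Category.{v} C] [MonoidalCategory C] [HasFiniteProducts C]
    (X : C) : Prop :=
  ∃ n : ℕ, Nonempty (Retract X (∏ᶜ fun _ : Fin n => 𝟙_ C))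

end AzumayaMonoid

/-! Write `Z(X)` for `Hom(𝟙, X)`. The canonical map factors as `Z(A) ⊗ Z(A)ᵒᵖ → Z(Aᵉ) → End_C(A) →
End(Z(A))`, and each arrow is bijective.

The middle arrow sends an element of `Aᵉ` to its action on `A` (`act_env_injective`,
`act_env_surjective`). Since `A ⊗ -` is an equivalence, the regular module `Aᵉ` is isomorphic to
some `A ⊗ X`, where elements of `Aᵉ` act through `A` alone. An element is therefore determined by
its action on `A`. Conversely, fullness carries the generator of `A ⊗ X` to the coevaluation of `A`,
which detects endomorphisms of `A`; hence each of them is an action.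

The outer arrows come from the Künneth hypothesis, which gives `∑ pᵢ ≫ jᵢ = 𝟙 A`, a dual basis
inside `C`. It makes `Z(A)` finitely generated projective, makes `Z` compatible with `A ⊗ A`
(`kunnethMap_bijective`), and identifies linear endomorphisms of `Z(A)` with endomorphisms of `A`.
Faithfulness of `Z(A)` follows from that of the functor `A ⊗ -`. -/

namespace AzumayaMonoid

/-! ### Actions of elements of a monoid on its modules -/

section Action

variable {C : Type u} [Category.{v} C] [MonoidalCategory C] {R : C} [MonObj R]

/-- The endomorphism of an `R`-module `M` given by the action of an element `t : 𝟙 ⟶ R`. -/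
def act (t : 𝟙_ C ⟶ R) (M : C) [ModObj R M] : M ⟶ M :=
  (λ_ M).inv ≫ t ▷ M ≫ γ[R, M]

theorem act_comp (t : 𝟙_ C ⟶ R) {M N : C} [ModObj R M] [ModObj R N] (f : M ⟶ N)
    [IsModHom R f] : act t M ≫ f = f ≫ act t N := by
  have h : γ[R, M] ≫ f = R ◁ f ≫ γ[R, N] := IsModHom.smul_hom
  simp only [act, Category.assoc, h]
  rw [← whisker_exchange_assoc, leftUnitor_inv_naturality_assoc]

/-- Since `t · 1 = t`, an element can be recovered from its action on the regular module. -/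
theorem one_comp_act_regular (t : 𝟙_ C ⟶ R) :
    letI : ModObj R R := ModObj.regular R
    η ≫ act t R = t := by
  change η ≫ (λ_ R).inv ≫ t ▷ R ≫ μ = t
  rw [leftUnitor_inv_naturality_assoc, whisker_exchange_assoc, MonObj.mul_one,
    rightUnitor_naturality, ← unitors_equal, Iso.inv_hom_id_assoc]

theorem act_modTensor (t : 𝟙_ C ⟶ R) (M X : C) [ModObj R M] :
    letI := modTensor R M X
    act t (M ⊗ X) = act t M ▷ X := by
  change (λ_ (M ⊗ X)).inv ≫ t ▷ (M ⊗ X) ≫ (α_ R M X).inv ≫ γ[R, M] ▷ X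
    = ((λ_ M).inv ≫ t ▷ M ≫ γ[R, M]) ▷ X
  rw [associator_inv_naturality_left_assoc]
  simp

/-- The morphism `r ↦ r · w` from `R` to an `R`-module `N`, for an element `w : 𝟙 ⟶ N`. -/
def orbitMap {N : C} [ModObj R N] (w : 𝟙_ C ⟶ N) : R ⟶ N :=
  (ρ_ R).inv ≫ R ◁ w ≫ γ[R, N]

theorem one_comp_orbitMap {N : C} [ModObj R N] (w : 𝟙_ C ⟶ N) :
    η ≫ orbitMap (R := R) w = w := by
  rw [orbitMap, rightUnitor_inv_naturality_assoc, ← whisker_exchange_assoc,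
    ModObj.one_smul_self, leftUnitor_naturality, unitors_equal, Iso.inv_hom_id_assoc]

/-- The regular module is free on `η`: any element of `N` is the image of the unit under a module
morphism. -/
theorem isModHom_orbitMap {N : C} [ModObj R N] (w : 𝟙_ C ⟶ N) :
    letI : ModObj R R := ModObj.regular R
    IsModHom R (orbitMap (R := R) w) := by
  let : ModObj R R := ModObj.regular R
  refine ⟨?_⟩
  change μ ≫ (ρ_ R).inv ≫ R ◁ w ≫ γ[R, N] = R ◁ ((ρ_ R).inv ≫ R ◁ w ≫ γ[R, N]) ≫ γ[R, N]
  rw [rightUnitor_inv_naturality_assoc, ← whisker_exchange_assoc, ModObj.mul_smul_self]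
  simp

/-- By a triangle identity, a morphism out of `A` is recovered from its mate `𝟙 ⟶ B ⊗ D` by
evaluating `D` against `A`. -/
theorem coevaluation_comp_whiskerRight_injective (A D B : C) [ExactPairing A D] {f g : A ⟶ B}
    (h : η_ A D ≫ f ▷ D = η_ A D ≫ g ▷ D) : f = g := by
  have key (k : A ⟶ B) : k = (λ_ A).inv ≫ (η_ A D ≫ k ▷ D) ▷ A ≫ (α_ B D A).hom ≫
      B ◁ ε_ A D ≫ (ρ_ B).hom := by
    simp only [comp_whiskerRight, Category.assoc, associator_naturality_left_assoc]
    rw [← whisker_exchange_assoc, ExactPairing.evaluation_coevaluation_assoc]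
    simp
  rw [key f, key g, h]

end Action

/-! ### Elements of the enveloping monoid are the endomorphisms of `A` -/

section Env

variable {C : Type u} [Category.{v} C] [MonoidalCategory C] [SymmetricCategory C]

theorem act_env_injective (A : C) [MonObj A] [(envFunctor A).EssSurj] :
    Function.Injective fun t : 𝟙_ C ⟶ Env A => act t A := by
  intro s t hst
  dsimp only at hst
  let : ModObj (Env A) (Env A) := ModObj.regular (Env A)
  let X := (envFunctor A).objPreimage ⟨Env A⟩
  let := modTensor (Env A) A X
  let e : (envFunctor A).obj X ≅ ⟨Env A⟩ := (envFunctor A).objObjPreimageIso ⟨Env A⟩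
  let φ : A ⊗ X ⟶ Env A := e.hom.hom
  let ψ : Env A ⟶ A ⊗ X := e.inv.hom
  have : IsModHom (Env A) φ := e.hom.isModHom
  have hψφ : ψ ≫ φ = 𝟙 _ := congrArg Mod.Hom.hom e.inv_hom_id
  -- Transport the identity `r · 1 = r` along `Aᵉ ≅ A ⊗ X`; the right side depends on `r` only
  -- through its action on `A`.
  have key (r : 𝟙_ C ⟶ Env A) : r = η ≫ ψ ≫ act r A ▷ X ≫ φ := by
    rw [← act_modTensor r A X, act_comp, reassoc_of% hψφ]
    exact (one_comp_act_regular r).symm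
  rw [key s, key t, hst]

/-- Let `u = η ≫ ψ` be the generator of `A ⊗ X ≅ Aᵉ`. The preimage `t` of `(g ⊗ X)(u)` acts on `u`
as `g ⊗ X` does; pushing this equality from `X` to the dual of `A` turns `u` into the coevaluation
and forces `t` to act as `g`. -/
theorem act_env_surjective (A : C) [MonObj A] [(envFunctor A).EssSurj] [(envFunctor A).Full]
    [HasRightDual A] : Function.Surjective fun t : 𝟙_ C ⟶ Env A => act t A := by
  intro g
  let : ModObj (Env A) (Env A) := ModObj.regular (Env A)
  let X := (envFunctor A).objPreimage ⟨Env A⟩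
  let := modTensor (Env A) A X
  let := modTensor (Env A) A (Aᘁ)
  let e : (envFunctor A).obj X ≅ ⟨Env A⟩ := (envFunctor A).objObjPreimageIso ⟨Env A⟩
  let φ : A ⊗ X ⟶ Env A := e.hom.hom
  let ψ : Env A ⟶ A ⊗ X := e.inv.hom
  have : IsModHom (Env A) ψ := e.inv.isModHom
  have hφψ : φ ≫ ψ = 𝟙 _ := congrArg Mod.Hom.hom e.hom_inv_id
  have hψφ : ψ ≫ φ = 𝟙 _ := congrArg Mod.Hom.hom e.inv_hom_id
  -- The module morphism sending `1` to the coevaluation; fullness then writes it, through `A ⊗ X`,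
  -- as `A ◁ h`.
  let q : (⟨Env A⟩ : Mod C (Env A)) ⟶ (envFunctor A).obj (Aᘁ) :=
    Mod.Hom.mk'' (orbitMap (R := Env A) (η_ A (Aᘁ)))
      (isModHom_orbitMap (R := Env A) (η_ A (Aᘁ))).smul_hom
  obtain ⟨h, hh⟩ := (envFunctor A).map_surjective (e.hom ≫ q)
  have hh' : A ◁ h = φ ≫ orbitMap (R := Env A) (η_ A (Aᘁ)) := congrArg Mod.Hom.hom hh
  have hcoev : (η ≫ ψ) ≫ A ◁ h = η_ A (Aᘁ) := by
    rw [hh', Category.assoc, reassoc_of% hψφ, one_comp_orbitMap]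
  let t : 𝟙_ C ⟶ Env A := (η ≫ ψ) ≫ g ▷ X ≫ φ
  refine ⟨t, coevaluation_comp_whiskerRight_injective A (Aᘁ) A ?_⟩
  have ht : (η ≫ ψ) ≫ act t A ▷ X = (η ≫ ψ) ≫ g ▷ X := by
    rw [← act_modTensor t A X, Category.assoc, ← act_comp, ← Category.assoc,
      one_comp_act_regular]
    simp only [t, Category.assoc, hφψ, Category.comp_id]
  dsimp only
  -- `A ◁ h` commutes with endomorphisms acting on the factor `A`, so the claim reduces to `ht`.
  rw [← hcoev, Category.assoc, Category.assoc (η ≫ ψ), whisker_exchange, whisker_exchange,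
    ← Category.assoc, ht, Category.assoc]

end Env

/-! ### The enveloping action on elements -/

section Elements

variable {C : Type u} [Category.{v} C] [MonoidalCategory C] [SymmetricCategory C]

/-- On elements the symmetry only swaps the two factors, because the braiding of `𝟙` with itself is
trivial. -/
theorem comp_act_env (A : C) [MonObj A] (a b x : 𝟙_ C ⟶ A) :
    x ≫ act ((λ_ (𝟙_ C)).inv ≫ (a ⊗ₘ b) : 𝟙_ C ⟶ Env A) A = unitMul A a (unitMul A x b) := by
  change x ≫ (λ_ A).inv ≫ ((λ_ (𝟙_ C)).inv ≫ (a ⊗ₘ b)) ▷ A ≫ (α_ A A A).hom ≫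
    A ◁ ((β_ A A).hom ≫ μ) ≫ μ = unitMul A a (unitMul A x b)
  have h : unitMul A x b = (λ_ (𝟙_ C)).inv ≫ (b ⊗ₘ x) ≫ (β_ A A).hom ≫ μ := by
    rw [BraidedCategory.braiding_naturality_assoc, braiding_tensorUnit_left, unitors_equal]
    simp [unitMul, unitors_inv_equal]
  have h1 : x ≫ (λ_ A).inv ≫ ((λ_ (𝟙_ C)).inv ≫ (a ⊗ₘ b)) ▷ A
      = (λ_ (𝟙_ C)).inv ≫ (λ_ (𝟙_ C)).inv ▷ 𝟙_ C ≫ ((a ⊗ₘ b) ⊗ₘ x) := by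
    rw [leftUnitor_inv_naturality_assoc, whisker_exchange, comp_whiskerRight, Category.assoc,
      ← MonoidalCategory.tensorHom_def]
  have h2 (p : 𝟙_ C ⊗ 𝟙_ C ⟶ A) : unitMul A a ((λ_ (𝟙_ C)).inv ≫ p)
      = (λ_ (𝟙_ C)).inv ≫ 𝟙_ C ◁ (λ_ (𝟙_ C)).inv ≫ (a ⊗ₘ p) ≫ μ := by
    simp [unitMul, MonoidalCategory.tensorHom_def']
  have h3 : (a ⊗ₘ (b ⊗ₘ x) ≫ (β_ A A).hom ≫ μ) = (a ⊗ₘ (b ⊗ₘ x)) ≫ A ◁ ((β_ A A).hom ≫ μ) := by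
    rw [← id_tensorHom, tensorHom_comp_tensorHom, Category.comp_id]
  rw [h, h2, h3]
  simp only [← Category.assoc] at h1 ⊢
  rw [h1]
  simp only [Category.assoc]
  rw [associator_naturality_assoc]
  monoidal

end Elements

/-- Finite products are biproducts here, so the identity of the power of `𝟙` is the sum of its
projections followed by inclusions; restrict this along the retraction. -/
theorem IsKunneth.exists_sum_comp_eq_id {C : Type u} [Category.{v} C] [Preadditive C]
    [MonoidalCategory C] [HasFiniteProducts C] {X : C} (hX : IsKunneth X) :
    ∃ (n : ℕ) (p : Fin n → (X ⟶ 𝟙_ C)) (j : Fin n → (𝟙_ C ⟶ X)), ∑ i, p i ≫ j i = 𝟙 X := by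
  classical
  obtain ⟨n, ⟨r⟩⟩ := hX
  have := HasFiniteBiproducts.of_hasFiniteProducts (C := C)
  let e := biproduct.isoProduct fun _ : Fin n => 𝟙_ C
  refine ⟨n, fun i => r.i ≫ e.inv ≫ biproduct.π _ i, fun i =>
    biproduct.ι (fun _ : Fin n => 𝟙_ C) i ≫ e.hom ≫ r.r, ?_⟩
  have h : ∑ i, (biproduct.π (fun _ : Fin n => 𝟙_ C) i ≫
      biproduct.ι (fun _ : Fin n => 𝟙_ C) i) = 𝟙 _ :=
    biproduct.total
  calc _ = r.i ≫ e.inv ≫ (∑ i, (biproduct.π (fun _ : Fin n => 𝟙_ C) i ≫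
      biproduct.ι (fun _ : Fin n => 𝟙_ C) i)) ≫
        e.hom ≫ r.r := by
        simp only [Preadditive.sum_comp, Preadditive.comp_sum, Category.assoc]
    _ = _ := by simp [h]

/-! ### Calculus of elements and scalars -/

section Elements

variable {C : Type u} [Category.{v} C] [MonoidalCategory C]

/-- A morphism `𝟙 ⟶ A`, as an element of `Z(A)`. -/
def Z.mk {A : C} (f : 𝟙_ C ⟶ A) : Z A := f

/-- An element of `Z(A)`, as a morphism `𝟙 ⟶ A`. -/
def Z.hom {A : C} (f : Z A) : 𝟙_ C ⟶ A := f

theorem Z.hom_mk {A : C} (f : 𝟙_ C ⟶ A) : (Z.mk f).hom = f := rfl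

theorem Z.hom_injective {A : C} : Function.Injective (Z.hom : Z A → (𝟙_ C ⟶ A)) := fun _ _ h => h

theorem Z.hom_zero [Preadditive C] {A : C} : (0 : Z A).hom = 0 := rfl

theorem Z.hom_add [Preadditive C] {A : C} (f g : Z A) : (f + g).hom = f.hom + g.hom := rfl

theorem Z.hom_sum [Preadditive C] {A : C} {J : Type*} (s : Finset J) (f : J → Z A) :
    (∑ i ∈ s, f i).hom = ∑ i ∈ s, (f i).hom := rfl

theorem smul_tensorHom_unit {A B : C} (r : 𝟙_ C ⟶ 𝟙_ C) (a : 𝟙_ C ⟶ A) (b : 𝟙_ C ⟶ B) :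
    (λ_ (𝟙_ C)).inv ≫ ((r ≫ a) ⊗ₘ b) = r ≫ (λ_ (𝟙_ C)).inv ≫ (a ⊗ₘ b) := by
  rw [unitors_inv_equal, rightUnitor_inv_naturality_assoc, ← tensorHom_id,
    tensorHom_comp_tensorHom, Category.id_comp]

theorem tensorHom_unit_smul {A B : C} (r : 𝟙_ C ⟶ 𝟙_ C) (a : 𝟙_ C ⟶ A) (b : 𝟙_ C ⟶ B) :
    (λ_ (𝟙_ C)).inv ≫ (a ⊗ₘ (r ≫ b)) = r ≫ (λ_ (𝟙_ C)).inv ≫ (a ⊗ₘ b) := by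
  rw [leftUnitor_inv_naturality_assoc, ← id_tensorHom, tensorHom_comp_tensorHom, Category.id_comp]

theorem tensorHom_unit_comp_tensorHom {A B : C} (a : 𝟙_ C ⟶ A) (b : 𝟙_ C ⟶ B) (p : A ⟶ 𝟙_ C)
    (q : B ⟶ 𝟙_ C) : ((λ_ (𝟙_ C)).inv ≫ (a ⊗ₘ b)) ≫ (p ⊗ₘ q) ≫ (λ_ (𝟙_ C)).hom
      = (b ≫ q) ≫ (a ≫ p) := by
  rw [Category.assoc, tensorHom_comp_tensorHom_assoc, MonoidalCategory.tensorHom_def',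
    Category.assoc, unitors_equal, rightUnitor_naturality, ← unitors_equal,
    leftUnitor_naturality_assoc, Iso.inv_hom_id_assoc]

variable [Preadditive C] [MonoidalPreadditive C] {A : C} [MonObj A]

theorem Z.hom_mul (f g : Z A) : (f * g).hom = unitMul A f.hom g.hom := rfl

theorem Z.hom_smul (r : End (𝟙_ C)) (f : Z A) : (r • f).hom = End.asHom r ≫ f.hom := rfl

end Elements

/-! ### Dual bases: `Z(A)` and its linear endomorphisms -/

section Kunneth

variable {C : Type u} [Category.{v} C] [Preadditive C] [MonoidalCategory C]
  [MonoidalPreadditive C] {A : C} [MonObj A]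

/-- Composition with `p : A ⟶ 𝟙`, as a linear form on `Z(A)`. -/
def compLinearForm (p : A ⟶ 𝟙_ C) : Z A →ₗ[End (𝟙_ C)] End (𝟙_ C) where
  toFun f := End.of (f.hom ≫ p)
  map_add' f g := Preadditive.add_comp _ _ _ f.hom g.hom p
  -- Multiplication in `End` is composition in the reverse order, hence the use of commutativity.
  map_smul' r f := (Category.assoc r f.hom p).trans (endUnit_comm r (f.hom ≫ p))

theorem sum_compLinearForm_smul {n : ℕ} {p : Fin n → (A ⟶ 𝟙_ C)} {j : Fin n → (𝟙_ C ⟶ A)}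
    (h : ∑ i, p i ≫ j i = 𝟙 A) (f : Z A) :
    ∑ i, compLinearForm (p i) f • Z.mk (j i) = f := by
  apply Z.hom_injective
  change ∑ i, (f.hom ≫ p i) ≫ j i = f.hom
  simp only [Category.assoc, ← Preadditive.comp_sum, h, Category.comp_id]

theorem projective_and_finite_of_sum_comp_eq_id {n : ℕ} {p : Fin n → (A ⟶ 𝟙_ C)}
    {j : Fin n → (𝟙_ C ⟶ A)} (h : ∑ i, p i ≫ j i = 𝟙 A) :
    Module.Projective (End (𝟙_ C)) (Z A) ∧ Module.Finite (End (𝟙_ C)) (Z A) := by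
  let s : (Fin n → End (𝟙_ C)) →ₗ[End (𝟙_ C)] Z A :=
    Fintype.linearCombination (End (𝟙_ C)) fun i => Z.mk (j i)
  let l : Z A →ₗ[End (𝟙_ C)] (Fin n → End (𝟙_ C)) := LinearMap.pi fun i => compLinearForm (p i)
  have hs (f : Z A) : s (l f) = f := sum_compLinearForm_smul h f
  exact ⟨Module.Projective.of_split l s (LinearMap.ext hs),
    Module.Finite.of_surjective s fun f => ⟨l f, hs f⟩⟩

/-- A linear `φ` is determined by its values on the generators `jᵢ`, and `∑ pᵢ ≫ φ(jᵢ)` is a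
morphism of `C` with the same values. -/
theorem exists_comp_eq_of_sum_comp_eq_id {n : ℕ} {p : Fin n → (A ⟶ 𝟙_ C)}
    {j : Fin n → (𝟙_ C ⟶ A)} (h : ∑ i, p i ≫ j i = 𝟙 A) (φ : Module.End (End (𝟙_ C)) (Z A)) :
    ∃ f : A ⟶ A, ∀ x : Z A, (φ x).hom = x.hom ≫ f := by
  refine ⟨∑ i, p i ≫ (φ (Z.mk (j i))).hom, fun x => ?_⟩
  conv_lhs => rw [← sum_compLinearForm_smul h x]
  simp only [map_sum, map_smul, Z.hom_sum, Z.hom_smul, Preadditive.comp_sum]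
  simp only [← Category.assoc]
  rfl

theorem act_add {R : C} [MonObj R] (s t : 𝟙_ C ⟶ R) (M : C) [ModObj R M] :
    act (s + t) M = act s M + act t M := by
  simp [act]

theorem act_zero {R : C} [MonObj R] (M : C) [ModObj R M] :
    act (0 : 𝟙_ C ⟶ R) M = 0 := by
  simp [act]

end Kunneth

/-! ### The Künneth isomorphism and the Azumaya property -/

section Symmetric

open scoped TensorProduct

variable {C : Type u} [Category.{v} C] [Preadditive C] [MonoidalCategory C]
  [MonoidalPreadditive C] [SymmetricCategory C] (A : C) [MonObj A]

/-- The canonical map `Z(A) ⊗ Z(A)ᵒᵖ ⟶ Z(Aᵉ)`. -/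
def kunnethMap : (Z A) ⊗[End (𝟙_ C)] (Z A)ᵐᵒᵖ →ₗ[End (𝟙_ C)] Z (Env A) :=
  TensorProduct.lift (LinearMap.mk₂ (End (𝟙_ C))
    (fun a b => (Z.mk ((λ_ (𝟙_ C)).inv ≫ (a.hom ⊗ₘ b.unop.hom)) : Z (A ⊗ A)))
    (fun a a' b => (congrArg ((λ_ (𝟙_ C)).inv ≫ ·)
      (MonoidalPreadditive.add_tensor a.hom a'.hom b.unop.hom)).trans (Preadditive.comp_add ..))
    (fun r a b => smul_tensorHom_unit r a.hom b.unop.hom)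
    (fun a b b' => (congrArg ((λ_ (𝟙_ C)).inv ≫ ·)
      (MonoidalPreadditive.tensor_add a.hom b.unop.hom b'.unop.hom)).trans
        (Preadditive.comp_add ..))
    (fun r a b => tensorHom_unit_smul r a.hom b.unop.hom))

/-- This is the factorization of the canonical algebra map through `Z(Aᵉ)` and `End_C(A)`; by
additivity it suffices to check pure tensors. -/
theorem mulLeftRight_eq_comp_act (z : (Z A) ⊗[End (𝟙_ C)] (Z A)ᵐᵒᵖ) (x : Z A) :
    (AlgHom.mulLeftRight (End (𝟙_ C)) (Z A) z x).hom = x.hom ≫ act (kunnethMap A z).hom A := by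
  induction z with
  | zero =>
    rw [map_zero, map_zero, LinearMap.zero_apply, Z.hom_zero, Z.hom_zero, act_zero, comp_zero]
  | tmul a b =>
    rw [AlgHom.mulLeftRight_apply, _root_.mul_assoc, Z.hom_mul, Z.hom_mul, ← comp_act_env]
    rfl
  | add y z hy hz =>
    rw [map_add, map_add, LinearMap.add_apply, Z.hom_add, Z.hom_add, act_add, Preadditive.comp_add,
      hy, hz]

variable {A}

/-- The `pᵢ ⊗ pₖ` and `jᵢ ⊗ jₖ` form a dual basis of `A ⊗ A`; the inverse `σ` reads off the
coordinates and puts them on the tensors `jᵢ ⊗ jₖ`. -/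
theorem kunnethMap_bijective {n : ℕ} {p : Fin n → (A ⟶ 𝟙_ C)}
    {j : Fin n → (𝟙_ C ⟶ A)} (h : ∑ i, p i ≫ j i = 𝟙 A) :
    Function.Bijective (kunnethMap A) := by
  let c (i k : Fin n) (t : 𝟙_ C ⟶ A ⊗ A) : End (𝟙_ C) :=
    End.of (t ≫ (p i ⊗ₘ p k) ≫ (λ_ (𝟙_ C)).hom)
  let σ (t : 𝟙_ C ⟶ A ⊗ A) : (Z A) ⊗[End (𝟙_ C)] (Z A)ᵐᵒᵖ :=
    ∑ i, ∑ k, c i k t • (Z.mk (j i) ⊗ₜ MulOpposite.op (Z.mk (j k)))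
  have hσ_add (s t : 𝟙_ C ⟶ A ⊗ A) : σ (s + t) = σ s + σ t := by
    have hc (i k : Fin n) : c i k (s + t) = c i k s + c i k t := Preadditive.add_comp _ _ _ _ _ _
    simp only [σ, hc, add_smul, Finset.sum_add_distrib]
  have hσ_zero : σ 0 = 0 := by
    have hc (i k : Fin n) : c i k 0 = 0 := zero_comp
    simp only [σ, hc, zero_smul, Finset.sum_const_zero]
  have hl (z : (Z A) ⊗[End (𝟙_ C)] (Z A)ᵐᵒᵖ) : σ (kunnethMap A z) = z := by
    induction z with
    | zero => rw [map_zero]; exact hσ_zero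
    | tmul a b =>
      have hc (i k : Fin n) : c i k (kunnethMap A (a ⊗ₜ b))
          = compLinearForm (p i) a * compLinearForm (p k) b.unop :=
        tensorHom_unit_comp_tensorHom a.hom b.unop.hom (p i) (p k)
      simp only [σ, hc]
      conv_rhs => rw [← sum_compLinearForm_smul h a, ← MulOpposite.op_unop b,
        ← sum_compLinearForm_smul h b.unop]
      simp only [Finset.op_sum, TensorProduct.sum_tmul, TensorProduct.tmul_sum,
        MulOpposite.op_smul, TensorProduct.smul_tmul_smul]
      exact Finset.sum_comm
    | add y z hy hz =>
      rw [map_add]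
      exact (hσ_add _ _).trans (by rw [hy, hz])
  have hr (t : 𝟙_ C ⟶ A ⊗ A) : kunnethMap A (σ t) = t := by
    simp only [σ, map_sum, map_smul]
    change ∑ i, ∑ k, (t ≫ (p i ⊗ₘ p k) ≫ (λ_ (𝟙_ C)).hom) ≫ (λ_ (𝟙_ C)).inv ≫ (j i ⊗ₘ j k) = t
    simp only [Category.assoc, Iso.hom_inv_id_assoc, tensorHom_comp_tensorHom,
      ← Preadditive.comp_sum, ← tensor_sum, ← sum_tensor, h]
    simp
  exact ⟨Function.LeftInverse.injective (g := σ) hl, fun t => ⟨σ t, hr t⟩⟩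

/-- Multiplying `A` by `r ≫ η` is, up to the unitor, `A ◁ r`; if it vanishes, faithfulness of `A ⊗
-` gives `r = 0`. -/
theorem eq_zero_of_comp_one_eq_zero [(envFunctor A).Faithful] {r : 𝟙_ C ⟶ 𝟙_ C}
    (hr : r ≫ (η : 𝟙_ C ⟶ A) = 0) : r = 0 := by
  apply (envFunctor A).map_injective
  apply Mod.hom_ext
  change A ◁ r = A ◁ (0 : 𝟙_ C ⟶ 𝟙_ C)
  have h : A ◁ (r ≫ η) ≫ μ = A ◁ r ≫ (ρ_ A).hom := by simp
  rw [hr, MonoidalPreadditive.whiskerLeft_zero, zero_comp] at h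
  rw [MonoidalPreadditive.whiskerLeft_zero, ← cancel_mono (ρ_ A).hom, ← h, zero_comp]

theorem faithfulSMul_Z [(envFunctor A).Faithful] : FaithfulSMul (End (𝟙_ C)) (Z A) where
  eq_of_smul_eq_smul {r s} h := by
    have h1 : (r - s) • (1 : Z A) = 0 := by rw [sub_smul, h 1, sub_self]
    exact sub_eq_zero.mp (eq_zero_of_comp_one_eq_zero (A := A) h1)

theorem mulLeftRight_bijective [(envFunctor A).IsEquivalence] [HasRightDual A] {n : ℕ}
    {p : Fin n → (A ⟶ 𝟙_ C)} {j : Fin n → (𝟙_ C ⟶ A)} (h : ∑ i, p i ≫ j i = 𝟙 A) :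
    Function.Bijective (AlgHom.mulLeftRight (End (𝟙_ C)) (Z A)) := by
  constructor
  · intro y z hyz
    apply (kunnethMap_bijective h).injective
    apply Z.hom_injective
    apply act_env_injective A
    dsimp only
    -- An endomorphism of `A` is determined by its effect on the elements `jᵢ`, where the two
    -- multiplication maps agree by `hyz`.
    have key (f : A ⟶ A) : f = ∑ i, p i ≫ j i ≫ f := by
      simp only [← Category.assoc, ← Preadditive.sum_comp, h, Category.id_comp]
    rw [key (act (kunnethMap A y).hom A), key (act (kunnethMap A z).hom A)]
    refine Finset.sum_congr rfl fun i _ => ?_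
    have hi := mulLeftRight_eq_comp_act A y (Z.mk (j i))
    rw [hyz, mulLeftRight_eq_comp_act, Z.hom_mk] at hi
    rw [hi]
  · intro φ
    obtain ⟨f, hf⟩ := exists_comp_eq_of_sum_comp_eq_id h φ
    obtain ⟨t, ht⟩ := act_env_surjective A f
    obtain ⟨z, hz⟩ := (kunnethMap_bijective h).surjective (Z.mk t)
    refine ⟨z, LinearMap.ext fun x => Z.hom_injective ?_⟩
    rw [mulLeftRight_eq_comp_act, hz, hf, ← ht, Z.hom_mk]

end Symmetric

end AzumayaMonoid

theorem mainTheorem11 {C : Type u} [Category.{v} C] [Abelian C] [MonoidalCategory C]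
    [SymmetricCategory C] [MonoidalPreadditive C] [WellPowered.{v} C] [HasLimits C] [HasColimits C]
    [∀ X : C, PreservesFiniteColimits (tensorLeft X)]
    [∀ X : C, PreservesFiniteColimits (tensorRight X)]
    (A : C) [MonObj A] (hA : AzumayaMonoid.IsAzumayaMonoid A)
    (hdual : Nonempty (HasRightDual A)) (hK : AzumayaMonoid.IsKunneth A) :
    IsAzumaya (End (𝟙_ C)) (AzumayaMonoid.Z A) := by
  obtain ⟨_⟩ := hdual
  have := hA.isEquivalence
  obtain ⟨n, p, j, h⟩ := hK.exists_sum_comp_eq_id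
  obtain ⟨_, _⟩ := AzumayaMonoid.projective_and_finite_of_sum_comp_eq_id h
  have := AzumayaMonoid.faithfulSMul_Z (A := A)
  exact { bij := AzumayaMonoid.mulLeftRight_bijective h }
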